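/- Conventions. A map $h=(h_1,\ldots,h_m):U\to\mathbb{R}^m$ on an open semialgebraic set $U\subset\mathbb{R}^d$ is a Nash map if each $h_i$ is analytic and semialgebraic. A Nash atlas on a space $M$ is a family of charts $(U_i,\phi_i)$ covering $M$ such that all $\phi_i(U_i)$ are semialgebraic and all changes of charts $\phi_j\circ\phi_i^{-1}:\phi_i(U_i\cap U_j)\to\phi_j(U_i\cap U_j)$ are Nash maps. A continuous map $F:M\to N$ between spaces with Nash atlases is locally Nash if for each $p\in M$ there are charts $(U,\phi)$ of $M$ at $p$ and $(V,\psi)$ of $N$ at $F(p)$ and an open $U'\subset U$ with $p\in U'$, $F(U')\subset V$, such that $\psi\circ F\circ\phi^{-1}$ is a Nash map on $\phi(U')$. A locally Nash group is a group with a Nash atlas for which the group operations are locally Nash maps; an isomorphism of locally Nash groups is a group isomorphism $F$ such that $F$ and $F^{-1}$ are locally Nash maps. A meromorphic function on $\mathbb{C}^m$ is a quotient of two entire functions on $\mathbb{C}^m$ (the denominator not identically zero). A real meromorphic map $f=(f_1,\ldots,f_n):\mathbb{C}^n\to\mathbb{C}^n$ is one whose coordinates $f_i$ are quotients of entire functions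 taking real values on $\mathbb{R}^n$. For $K\in\{\mathbb{R},\mathbb{C}\}$, a tuple of meromorphic functions is algebraic over $K(f)=K(f_1,\ldots,f_n)$ if each of its members is algebraic over this field. The map $f$ admits an algebraic addition theorem (AAT) if $f_1,\ldots,f_n$ are algebraically independent over $\mathbb{C}$ and each $f_i(u+v)$, as a meromorphic function of $(u,v)\in\mathbb{C}^{2n}$, is algebraic over $\mathbb{C}(f_1(u),\ldots,f_n(u),f_1(v),\ldots,f_n(v))$. For a real meromorphic map $f:\mathbb{C}^n\to\mathbb{C}^n$ admitting an AAT, $(\mathbb{R}^n,+,f)$ denotes any locally Nash group $(\mathbb{R}^n,+)$ whose atlas consists of all the translates $(a+V,\ u\mapsto\phi(u-a))$, $a\in\mathbb{R}^n$, of one chart $(V,\phi)$, where $V\subset\mathbb{R}^n$ is an open neighbourhood of $0$ and $\phi:V\to\mathbb{R}^n$, $\phi(u)=f(u+k)$ for some $k\in\mathbb{R}^n$, is an analytic diffeomorphism onto an open subset of $\mathbb{R}^n$. Statement. Let $(\mathbb{R}^n,+,f)$ and $(\mathbb{R}^n,+,g)$ be locally Nash groups, where $f,g:\mathbb{C}^n\to\mathbb{C}^n$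 are real meromorphic maps admitting an AAT. Then $(\mathbb{R}^n,+,f)$ and $(\mathbb{R}^n,+,g)$ are isomorphic as locally Nash groups if and only if there exists $\alpha\in GL_n(\mathbb{R})$ (acting linearly on $\mathbb{C}^n$) such that $g\circ\alpha$ is algebraic over $\mathbb{R}(f)$. -/

import Mathlib

noncomputable section

open Set Topology

/-! ### Semialgebraic sets, Nash maps, locally Nash groups -/

/-- Semialgebraic subsets of the affine space with coordinates indexed by `ι`: the smallest family
containing the sets `{x | 0 < p x}` (`p` a real polynomial) and closed under complements and finite
unions. -/
inductive IsSemialgebraic {ι : Type} : Set (ι → ℝ) → Prop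
  | pos (p : MvPolynomial ι ℝ) : IsSemialgebraic {x | 0 < MvPolynomial.eval x p}
  | compl {s : Set (ι → ℝ)} : IsSemialgebraic s → IsSemialgebraic sᶜ
  | union {s t : Set (ι → ℝ)} : IsSemialgebraic s → IsSemialgebraic t → IsSemialgebraic (s ∪ t)

/-- The graph of `h` restricted to `U`; the coordinate `none` is the value. -/
def graphOver {ι : Type} (U : Set (ι → ℝ)) (h : (ι → ℝ) → ℝ) : Set (Option ι → ℝ) :=
  {z | (fun i => z (some i)) ∈ U ∧ z none = h (fun i => z (some i))}

/-- `h : U → ℝ^κ` is a Nash map: `U` is an open semialgebraic set, and the coordinate functions of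
`h` are analytic and semialgebraic on `U`. -/
structure IsNashOn {ι κ : Type} [Fintype ι] [Fintype κ]
    (h : (ι → ℝ) → (κ → ℝ)) (U : Set (ι → ℝ)) : Prop where
  isOpen : IsOpen U
  semialgebraic_domain : IsSemialgebraic U
  analytic : ∀ i, AnalyticOnNhd ℝ (fun x => h x i) U
  semialgebraic : ∀ i, IsSemialgebraic (graphOver U (fun x => h x i))

/-- A set of charts of `M` is a Nash atlas: the charts cover `M`, their images are semialgebraic,
and all changes of charts are Nash maps (hence Nash diffeomorphisms, by symmetry). -/
structure IsNashAtlas {ι M : Type} [Fintype ι] [TopologicalSpace M]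
    (A : Set (OpenPartialHomeomorph M (ι → ℝ))) : Prop where
  cover : ∀ p : M, ∃ e ∈ A, p ∈ e.source
  semialgebraic_target : ∀ e ∈ A, IsSemialgebraic e.target
  transition : ∀ e ∈ A, ∀ e' ∈ A, IsNashOn (fun x => e' (e.symm x)) (e '' (e.source ∩ e'.source))

/-- `F` is a locally Nash map from `M` (with Nash atlas `A`) to `N` (with Nash atlas `B`). -/
def IsLocallyNashMap {ι κ M N : Type} [Fintype ι] [Fintype κ] [TopologicalSpace M]
    [TopologicalSpace N] (A : Set (OpenPartialHomeomorph M (ι → ℝ)))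
    (B : Set (OpenPartialHomeomorph N (κ → ℝ))) (F : M → N) : Prop :=
  Continuous F ∧ ∀ p : M, ∃ e ∈ A, ∃ e' ∈ B, ∃ U : Set M,
    IsOpen U ∧ p ∈ U ∧ U ⊆ e.source ∧ MapsTo F U e'.source ∧
      IsNashOn (fun x => e' (F (e.symm x))) (e '' U)

/-- The product chart of two charts, with values in `ℝ^(ι ⊕ κ) = ℝ^ι × ℝ^κ`. -/
def prodChart {ι κ M N : Type} [TopologicalSpace M] [TopologicalSpace N]
    (e : OpenPartialHomeomorph M (ι → ℝ)) (e' : OpenPartialHomeomorph N (κ → ℝ)) :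
    OpenPartialHomeomorph (M × N) (ι ⊕ κ → ℝ) :=
  (e.prod e').transHomeomorph Homeomorph.sumArrowHomeomorphProdArrow.symm

/-- The product atlas. -/
def prodAtlas {ι κ M N : Type} [TopologicalSpace M] [TopologicalSpace N]
    (A : Set (OpenPartialHomeomorph M (ι → ℝ))) (B : Set (OpenPartialHomeomorph N (κ → ℝ))) :
    Set (OpenPartialHomeomorph (M × N) (ι ⊕ κ → ℝ)) :=
  {E | ∃ e ∈ A, ∃ e' ∈ B, E = prodChart e e'}

/-- The additive group `G` with the atlas `A` is a locally Nash group: `A` is a Nash atlas and the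
group operations are locally Nash maps. -/
structure IsLocallyNashGroup {ι G : Type} [Fintype ι] [TopologicalSpace G] [AddGroup G]
    (A : Set (OpenPartialHomeomorph G (ι → ℝ))) : Prop where
  atlas : IsNashAtlas A
  add : IsLocallyNashMap (prodAtlas A A) A (fun p : G × G => p.1 + p.2)
  neg : IsLocallyNashMap A A (fun p : G => -p)

/-- `(G, A)` and `(H, B)` are isomorphic as locally Nash groups: there is a group isomorphism which
is a locally Nash map together with its inverse (it is then an analytic diffeomorphism, because
Nash maps are analytic). -/
def LocallyNashIsomorphic {ι κ G H : Type} [Fintype ι] [Fintype κ]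
    [TopologicalSpace G] [AddGroup G] [TopologicalSpace H] [AddGroup H]
    (A : Set (OpenPartialHomeomorph G (ι → ℝ))) (B : Set (OpenPartialHomeomorph H (κ → ℝ))) :
    Prop :=
  ∃ F : G ≃+ H, IsLocallyNashMap A B F ∧ IsLocallyNashMap B A F.symm

/-- The atlas of all translates `(g + U, u ↦ φ (-g + u))` of a chart `(U, φ)`. -/
def translateAtlas {ι G : Type} [TopologicalSpace G] [AddGroup G] [IsTopologicalAddGroup G]
    (φ : OpenPartialHomeomorph G (ι → ℝ)) : Set (OpenPartialHomeomorph G (ι → ℝ)) :=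
  range fun g : G => (Homeomorph.addLeft (-g)).transOpenPartialHomeomorph φ

/-! ### Meromorphic functions -/

/-- The ring of entire functions on a complex normed space. -/
def Entire (E : Type) [NormedAddCommGroup E] [NormedSpace ℂ E] : Subalgebra ℂ (E → ℂ) where
  carrier := {f | AnalyticOnNhd ℂ f univ}
  mul_mem' hf hg := hf.mul hg
  add_mem' hf hg := hf.add hg
  algebraMap_mem' _ := analyticOnNhd_const

instance instIsDomainEntire (E : Type) [NormedAddCommGroup E] [NormedSpace ℂ E] :
    IsDomain (Entire E) := by
  have : NoZeroDivisors (Entire E) := by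
    refine ⟨fun {a b} hab => ?_⟩
    by_contra! h
    obtain ⟨ha, hb⟩ := h
    have hz : ∃ z, (a : E → ℂ) z ≠ 0 := by
      by_contra! hz
      exact ha (Subtype.ext (funext hz))
    obtain ⟨z, hz⟩ := hz
    have hca : ContinuousAt (a : E → ℂ) z := (a.2 z (mem_univ z)).continuousAt
    have hev : (b : E → ℂ) =ᶠ[𝓝 z] fun _ => (0 : ℂ) := by
      filter_upwards [hca.eventually_ne hz] with w hw
      have := congrFun (congrArg Subtype.val hab) w
      exact (mul_eq_zero.mp this).resolve_left hw
    exact hb (Subtype.ext (AnalyticOnNhd.eq_of_eventuallyEq b.2 analyticOnNhd_const hev))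
  exact NoZeroDivisors.to_isDomain _

/-- The field of meromorphic functions: quotients of entire functions. -/
abbrev Mero (E : Type) [NormedAddCommGroup E] [NormedSpace ℂ E] : Type :=
  FractionRing (Entire E)

/-- Composition `h ↦ h ∘ L` on entire functions, for a continuous linear map `L`. -/
def Entire.comp {E F : Type} [NormedAddCommGroup E] [NormedSpace ℂ E]
    [NormedAddCommGroup F] [NormedSpace ℂ F] (L : E →L[ℂ] F) : Entire F →+* Entire E where
  toFun h := ⟨fun x => (h : F → ℂ) (L x), fun x _ => (h.2 (L x) (mem_univ _)).comp (L.analyticAt x)⟩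
  map_one' := rfl
  map_mul' _ _ := rfl
  map_zero' := rfl
  map_add' _ _ := rfl

theorem Entire.comp_injective {E F : Type} [NormedAddCommGroup E] [NormedSpace ℂ E]
    [NormedAddCommGroup F] [NormedSpace ℂ F] (L : E →L[ℂ] F) (hL : Function.Surjective L) :
    Function.Injective (Entire.comp L) := by
  intro a b hab
  refine Subtype.ext (funext fun y => ?_)
  obtain ⟨x, rfl⟩ := hL y
  exact congrFun (congrArg Subtype.val hab) x

/-- Composition `f ↦ f ∘ L` on meromorphic functions, for a surjective continuous linear map. -/
def Mero.comp {E F : Type} [NormedAddCommGroup E] [NormedSpace ℂ E]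
    [NormedAddCommGroup F] [NormedSpace ℂ F] (L : E →L[ℂ] F) (hL : Function.Surjective L) :
    Mero F →+* Mero E :=
  IsFractionRing.map (Entire.comp_injective L hL)

/-- `g` is algebraic over the field `K(f)`: every `g i` is. -/
def IsAlgebraicOver (K : Type) {L ι κ : Type} [Field K] [Field L] [Algebra K L]
    (g : κ → L) (f : ι → L) : Prop :=
  ∀ i, IsAlgebraic (IntermediateField.adjoin K (range f)) (g i)

/-! ### Real meromorphic maps `ℂ^n → ℂ^n` and algebraic addition theorems -/

/-- `ℂ^n`. -/
abbrev Cn (n : ℕ) : Type := Fin n → ℂ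

/-- `ℝ^n`. -/
abbrev Rn (n : ℕ) : Type := Fin n → ℝ

/-- The inclusion of `ℝ^n` in `ℂ^n`. -/
def toCn {n : ℕ} (x : Rn n) : Cn n := fun i => (x i : ℂ)

/-- An entire function is real if it is real valued on `ℝ^n`. -/
def IsRealEntire {n : ℕ} (h : Entire (Cn n)) : Prop :=
  ∀ x : Rn n, ((h : Cn n → ℂ) (toCn x)).im = 0

/-- Each coordinate function is a quotient of two real entire functions. -/
def IsRealMeromorphic {n : ℕ} (f : Fin n → Mero (Cn n)) : Prop :=
  ∀ i, ∃ a b : Entire (Cn n), IsRealEntire a ∧ IsRealEntire b ∧ b ≠ 0 ∧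
    f i = algebraMap (Entire (Cn n)) (Mero (Cn n)) a / algebraMap (Entire (Cn n)) (Mero (Cn n)) b

/-- The meromorphic function `h(u)` of `(u, v)`. -/
def Mero.left {n : ℕ} (h : Mero (Cn n)) : Mero (Cn n × Cn n) :=
  Mero.comp (ContinuousLinearMap.fst ℂ (Cn n) (Cn n)) Prod.fst_surjective h

/-- The meromorphic function `h(v)` of `(u, v)`. -/
def Mero.right {n : ℕ} (h : Mero (Cn n)) : Mero (Cn n × Cn n) :=
  Mero.comp (ContinuousLinearMap.snd ℂ (Cn n) (Cn n)) Prod.snd_surjective h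

theorem addMap_surjective (n : ℕ) : Function.Surjective
    (ContinuousLinearMap.fst ℂ (Cn n) (Cn n) + ContinuousLinearMap.snd ℂ (Cn n) (Cn n)) :=
  fun y => ⟨(y, 0), by simp⟩

/-- The meromorphic function `h(u + v)` of `(u, v)`. -/
def Mero.sum {n : ℕ} (h : Mero (Cn n)) : Mero (Cn n × Cn n) :=
  Mero.comp (ContinuousLinearMap.fst ℂ (Cn n) (Cn n) + ContinuousLinearMap.snd ℂ (Cn n) (Cn n))
    (addMap_surjective n) h

/-- `f` admits an algebraic addition theorem: its coordinate functions are algebraically independent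
over `ℂ`, and `f(u + v)` is algebraic over `ℂ(f(u), f(v))`. -/
structure AdmitsAAT {n : ℕ} (f : Fin n → Mero (Cn n)) : Prop where
  algebraicIndependent : AlgebraicIndependent ℂ f
  addition : IsAlgebraicOver ℂ (fun i => (f i).sum)
    (Sum.elim (fun i => (f i).left) (fun i => (f i).right))

/-- The linear map of `ℂ^n` given by a real matrix. -/
def complexify {n : ℕ} (α : Matrix.GeneralLinearGroup (Fin n) ℝ) : Cn n →L[ℂ] Cn n :=
  LinearMap.toContinuousLinearMap
    (Matrix.mulVecLin ((α : Matrix (Fin n) (Fin n) ℝ).map Complex.ofRealHom))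

theorem complexify_surjective {n : ℕ} (α : Matrix.GeneralLinearGroup (Fin n) ℝ) :
    Function.Surjective (complexify α) := by
  intro y
  refine ⟨((α⁻¹ : Matrix.GeneralLinearGroup (Fin n) ℝ) : Matrix (Fin n) (Fin n) ℝ).map
    Complex.ofRealHom |>.mulVec y, ?_⟩
  simp [complexify, Matrix.mulVec_mulVec]

/-- The meromorphic map `g ∘ α`. -/
def compGL {n : ℕ} (g : Fin n → Mero (Cn n)) (α : Matrix.GeneralLinearGroup (Fin n) ℝ) :
    Fin n → Mero (Cn n) :=
  fun i => Mero.comp (complexify α) (complexify_surjective α) (g i)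

/-- `φ` is an analytic diffeomorphism from an open neighbourhood of `0` in `ℝ^n` onto an open subset
of `ℝ^n`, and there is `k ∈ ℝ^n` with `φ(u) = f(u + k)` on its domain. The last equality of
functions analytic on the domain is expressed after multiplication with denominators:
`b(u + k) φᵢ(u) = a(u + k)` whenever `fᵢ b = a`. -/
structure IsChartOf {n : ℕ} (f : Fin n → Mero (Cn n))
    (φ : OpenPartialHomeomorph (Rn n) (Rn n)) : Prop where
  zero_mem : 0 ∈ φ.source
  analytic : AnalyticOnNhd ℝ φ φ.source
  analytic_symm : AnalyticOnNhd ℝ φ.symm φ.target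
  eq_translate : ∃ k : Rn n, ∀ (i : Fin n) (a b : Entire (Cn n)),
    f i * algebraMap (Entire (Cn n)) (Mero (Cn n)) b = algebraMap (Entire (Cn n)) (Mero (Cn n)) a →
      ∀ u ∈ φ.source, (b : Cn n → ℂ) (toCn (u + k)) * ((φ u i : ℝ) : ℂ) =
        (a : Cn n → ℂ) (toCn (u + k))

/-- The atlas `A` on `(ℝ^n, +)` is one of the locally Nash group structures denoted
`(ℝ^n, +, f)`: it consists of the translates of a chart `u ↦ f(u + k)` around `0`, and makes
`(ℝ^n, +)` a locally Nash group. -/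
def IsStructureOf {n : ℕ} (f : Fin n → Mero (Cn n))
    (A : Set (OpenPartialHomeomorph (Rn n) (Rn n))) : Prop :=
  IsLocallyNashGroup A ∧ ∃ φ, IsChartOf f φ ∧ A = translateAtlas φ

end

/-! A continuous additive automorphism of `ℝ^n` is linear, so an isomorphism is a matrix `α`. What
remains is to show that `α` is locally Nash exactly when `g ∘ α` is algebraic over `ℝ(f)`.

From Nash to algebraic: the frontier of a semialgebraic set lies in a proper algebraic set, and a
graph has empty interior, so every semialgebraic function satisfies a nontrivial polynomial
equation. In charts this is a polynomial relation between real translates of `f` and `g ∘ α` on an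
open subset of `ℝ^n`. The identity theorem makes it a relation between meromorphic functions
(`IsNashOn.isAlgebraicOver`).

From algebraic to Nash: a relation of minimal degree has a derivative that is not identically zero.
Near a point where the derivative is nonzero the relation has a single root in a small interval, so
the graph is semialgebraic there (`exists_nash_of_isAlgebraicOver`). One such point is enough: `α`
is additive and the atlases are translation invariant, so its local expression can be moved to any
other point.

Charts involve translates of `f`, and `IsStructureOf.isAlgebraicOver_shift` removes them: changes of
charts give small translations, and sums of these give all. For the inverse of `α`, equality of
transcendence degrees reverses the algebraic dependence (`IsAlgebraicOver.symm`). -/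

noncomputable section

open Set Topology

/-! ### Algebraic dependence of tuples -/

namespace IsAlgebraicOver

variable {K L L' ι κ τ : Type} [Field K] [Field L] [Field L'] [Algebra K L] [Algebra K L']

theorem trans {h : τ → L} {g : κ → L} {f : ι → L} (hg : IsAlgebraicOver K h g)
    (gf : IsAlgebraicOver K g f) : IsAlgebraicOver K h f := by
  intro i
  let F := IntermediateField.adjoin K (range f)
  let C := (algebraicClosure F L).restrictScalars K
  have hle : IntermediateField.adjoin K (range g) ≤ C := by
    rw [IntermediateField.adjoin_le_iff]
    rintro _ ⟨j, rfl⟩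
    exact mem_algebraicClosure_iff.2 (gf j)
  have h1 : IsAlgebraic C (h i) := (hg i).tower_top_of_subalgebra_le (A := IntermediateField.toSubalgebra _) (B := C.toSubalgebra) hle
  have h2 : IsAlgebraic (algebraicClosure F L) (h i) := h1
  exact h2.restrictScalars F

theorem map {g : κ → L} {f : ι → L} (h : IsAlgebraicOver K g f) (σ : L →ₐ[K] L') :
    IsAlgebraicOver K (fun i => σ (g i)) (fun i => σ (f i)) := by
  intro i
  have key : range (fun i => σ (f i)) = σ '' range f := by
    rw [← range_comp]; rfl
  have h1 := h i
  -- Coefficients are taken in the generated algebra rather than the field, so that `σ` carries a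
  -- relation over one to a relation over the other.
  rw [IntermediateField.isAlgebraic_adjoin_iff] at h1 ⊢
  rw [key, ← AlgHom.map_adjoin]
  obtain ⟨p, hp, hp0⟩ := h1
  let τ : Algebra.adjoin K (range f) →+* (Algebra.adjoin K (range f)).map σ :=
    (σ.toRingHom.comp (Algebra.adjoin K (range f)).val.toRingHom).codRestrict
      ((Algebra.adjoin K (range f)).map σ) fun x => ⟨x, x.2, rfl⟩
  have hτ : Function.Injective τ := fun x y hxy =>
    Subtype.ext (σ.toRingHom.injective (congrArg Subtype.val hxy))
  refine ⟨p.map τ, (Polynomial.map_ne_zero_iff hτ).2 hp, ?_⟩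
  rw [Polynomial.aeval_def, Polynomial.eval₂_map]
  exact (Polynomial.hom_eval₂ p _ σ.toRingHom (g i)).symm.trans
    ((congrArg σ hp0).trans (map_zero σ))

/-- This turns algebraicity over a field of fractions into a polynomial relation in the variables
`Option ι`, the same indexing as in `graphOver`. -/
theorem iff_not_algebraicIndependent {g : κ → L} {f : ι → L} (hf : AlgebraicIndependent K f) :
    IsAlgebraicOver K g f ↔
      ∀ i, ¬ AlgebraicIndependent K (fun o : Option ι => o.elim (g i) f) := by
  refine forall_congr' fun i => ?_
  rw [hf.option_iff_transcendental, IntermediateField.isAlgebraic_adjoin_iff, Transcendental,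
    not_not]

/-- In the matroid of algebraic independence, `range f` spans `range g`, and both are independent
with the same finite cardinality. Hence they have the same closure. -/
theorem symm [Finite ι] {g f : ι → L} (h : IsAlgebraicOver K g f) (hf : AlgebraicIndependent K f)
    (hg : AlgebraicIndependent K g) : IsAlgebraicOver K f g := by
  let M := AlgebraicIndependent.matroid K L
  have hsub : range g ⊆ M.closure (range f) := by
    rintro _ ⟨i, rfl⟩
    rw [AlgebraicIndependent.matroid_closure_eq]
    exact IntermediateField.isAlgebraic_adjoin_iff.1 (h i)
  have hfi : M.Indep (range f) := AlgebraicIndependent.matroid_indep_iff.2 hf.to_subtype_range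
  have hgi : M.Indep (range g) := AlgebraicIndependent.matroid_indep_iff.2 hg.to_subtype_range
  have hY : M.closure (range f ∪ range g) = M.closure (range f) := by
    refine subset_antisymm ?_ (M.closure_subset_closure subset_union_left)
    rw [← M.closure_closure (range f)]
    exact M.closure_subset_closure (union_subset (M.subset_closure _) hsub)
  have hrk : M.eRk (range f ∪ range g) ≤ M.eRk (range g) := by
    rw [← M.eRk_closure_eq, hY, M.eRk_closure_eq, hfi.eRk_eq_encard, hgi.eRk_eq_encard,
      ← image_univ, ← image_univ, hf.injective.encard_image, hg.injective.encard_image]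
  have hcl := (M.isRkFinite_of_finite (finite_range g)).closure_eq_closure_of_subset_of_eRk_ge_eRk
    subset_union_right hrk
  intro i
  rw [IntermediateField.isAlgebraic_adjoin_iff]
  have hmem : f i ∈ M.closure (range g) := by
    rw [hcl, hY]
    exact M.subset_closure _ (subset_univ _) ⟨i, rfl⟩
  rwa [AlgebraicIndependent.matroid_closure_eq] at hmem

end IsAlgebraicOver

/-! ### Separable polynomial relations -/

theorem MvPolynomial.aeval_option_elim {K L ι : Type} [Field K] [Field L] [Algebra K L]
    (f : ι → L) (y : L) (P : MvPolynomial (Option ι) K) :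
    MvPolynomial.aeval (fun o : Option ι => o.elim y f) P =
      (MvPolynomial.optionEquivLeft K ι P).eval₂
        (MvPolynomial.aeval f : MvPolynomial ι K →ₐ[K] L).toRingHom y := by
  induction P using MvPolynomial.induction_on with
  | C a => simp [MvPolynomial.optionEquivLeft_C]
  | add p q hp hq => simp only [map_add, Polynomial.eval₂_add, hp, hq]
  | mul_X p o hp =>
    rw [map_mul, map_mul, Polynomial.eval₂_mul, hp]
    cases o <;> simp [MvPolynomial.optionEquivLeft_X_none, MvPolynomial.optionEquivLeft_X_some]

/-- A polynomial of minimal degree witnessing algebraic dependence is separable at the root. -/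
theorem exists_eval₂_eq_zero_derivative_ne_zero {K L ι : Type} [Field K] [CharZero K] [Field L]
    [Algebra K L] {f : ι → L} (hf : AlgebraicIndependent K f) {y : L}
    (h : ¬ AlgebraicIndependent K (fun o : Option ι => o.elim y f)) :
    ∃ p : Polynomial (MvPolynomial ι K),
      p.eval₂ (MvPolynomial.aeval f : MvPolynomial ι K →ₐ[K] L).toRingHom y = 0 ∧
      p.derivative.eval₂ (MvPolynomial.aeval f : MvPolynomial ι K →ₐ[K] L).toRingHom y ≠ 0 := by
  classical
  set F : MvPolynomial ι K →+* L := (MvPolynomial.aeval f : MvPolynomial ι K →ₐ[K] L).toRingHom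
  have hF : Function.Injective F := hf
  have hex : ∃ d : ℕ, ∃ p : Polynomial (MvPolynomial ι K),
      p ≠ 0 ∧ p.eval₂ F y = 0 ∧ p.natDegree = d := by
    rw [algebraicIndependent_iff] at h
    push Not at h
    obtain ⟨P, hP, hP0⟩ := h
    refine ⟨_, MvPolynomial.optionEquivLeft K ι P, ?_, ?_, rfl⟩
    · simpa using hP0
    · rwa [MvPolynomial.aeval_option_elim] at hP
  obtain ⟨p, hp, hpy, hd⟩ := Nat.find_spec hex
  refine ⟨p, hpy, fun hder => ?_⟩
  -- In degree `0` the relation would involve `f` alone, against independence. Otherwise a vanishing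
  -- derivative would be a nonzero relation of smaller degree.
  by_cases h0 : p.natDegree = 0
  · rw [Polynomial.eq_C_of_natDegree_eq_zero h0, Polynomial.eval₂_C] at hpy
    apply hp
    rw [Polynomial.eq_C_of_natDegree_eq_zero h0, hF (hpy.trans (map_zero F).symm), map_zero]
  · refine Nat.find_min hex (m := p.derivative.natDegree) ?_ ⟨_, ?_, hder, rfl⟩
    · rw [← hd]
      exact Polynomial.natDegree_derivative_lt h0
    · intro hz
      exact h0 (Polynomial.derivative_eq_zero.1 hz)

/-! ### Translations and linear substitutions of meromorphic functions -/

theorem Mero.ringHom_ext {E R : Type} [NormedAddCommGroup E] [NormedSpace ℂ E] [Semiring R]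
    {σ τ : Mero E →+* R}
    (h : ∀ a : Entire E, σ (algebraMap (Entire E) (Mero E) a) =
      τ (algebraMap (Entire E) (Mero E) a)) : σ = τ :=
  IsLocalization.ringHom_ext (nonZeroDivisors (Entire E)) (RingHom.ext h)

/-- The entire function `u ↦ h (u + c)`. -/
def Entire.shift {E : Type} [NormedAddCommGroup E] [NormedSpace ℂ E] (c : E) :
    Entire E →+* Entire E where
  toFun h := ⟨fun x => (h : E → ℂ) (x + c), fun x _ =>
    AnalyticAt.fun_comp (g := (h : E → ℂ)) (h.2 (x + c) (mem_univ _))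
      (analyticAt_id.add analyticAt_const)⟩
  map_one' := rfl
  map_mul' _ _ := rfl
  map_zero' := rfl
  map_add' _ _ := rfl

theorem Entire.shift_injective {E : Type} [NormedAddCommGroup E] [NormedSpace ℂ E] (c : E) :
    Function.Injective (Entire.shift c) := by
  intro a b hab
  refine Subtype.ext (funext fun y => ?_)
  have := congrFun (congrArg Subtype.val hab) (y - c)
  simpa [Entire.shift] using this

theorem Mero.map_algebraMap {E F : Type} [NormedAddCommGroup E] [NormedSpace ℂ E]
    [NormedAddCommGroup F] [NormedSpace ℂ F] {σ : Entire E →+* Entire F}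
    (hσ : Function.Injective σ) (a : Entire E) :
    (IsFractionRing.map hσ : Mero E →+* Mero F) (algebraMap (Entire E) (Mero E) a) =
      algebraMap (Entire F) (Mero F) (σ a) :=
  IsLocalization.map_eq (nonZeroDivisors_le_comap_nonZeroDivisors_of_injective σ hσ) a

/-- The meromorphic function `u ↦ h (u + c)`. -/
def Mero.shift {E : Type} [NormedAddCommGroup E] [NormedSpace ℂ E] (c : E) :
    Mero E →ₐ[ℝ] Mero E where
  toRingHom := IsFractionRing.map (Entire.shift_injective c)
  commutes' r := by
    rw [IsScalarTower.algebraMap_apply ℝ (Entire E) (Mero E)]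
    exact Mero.map_algebraMap _ _

theorem Mero.shift_algebraMap {E : Type} [NormedAddCommGroup E] [NormedSpace ℂ E] (c : E)
    (a : Entire E) : Mero.shift c (algebraMap (Entire E) (Mero E) a) =
      algebraMap (Entire E) (Mero E) (Entire.shift c a) :=
  Mero.map_algebraMap (Entire.shift_injective c) a

/-- `Mero.comp` as a homomorphism of real algebras. -/
def Mero.compAlgHom {E F : Type} [NormedAddCommGroup E] [NormedSpace ℂ E]
    [NormedAddCommGroup F] [NormedSpace ℂ F] (L : E →L[ℂ] F) (hL : Function.Surjective L) :
    Mero F →ₐ[ℝ] Mero E where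
  toRingHom := Mero.comp L hL
  commutes' r := by
    rw [IsScalarTower.algebraMap_apply ℝ (Entire F) (Mero F),
      IsScalarTower.algebraMap_apply ℝ (Entire E) (Mero E)]
    exact Mero.map_algebraMap _ _

theorem Mero.compAlgHom_algebraMap {E F : Type} [NormedAddCommGroup E] [NormedSpace ℂ E]
    [NormedAddCommGroup F] [NormedSpace ℂ F] (L : E →L[ℂ] F) (hL : Function.Surjective L)
    (a : Entire F) : Mero.compAlgHom L hL (algebraMap (Entire F) (Mero F) a) =
      algebraMap (Entire E) (Mero E) (Entire.comp L a) :=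
  Mero.map_algebraMap (Entire.comp_injective L hL) a

theorem Mero.shift_shift {E : Type} [NormedAddCommGroup E] [NormedSpace ℂ E] (c d : E)
    (m : Mero E) : Mero.shift c (Mero.shift d m) = Mero.shift (c + d) m := by
  refine DFunLike.congr_fun (Mero.ringHom_ext (σ := ((Mero.shift c).comp (Mero.shift d)).toRingHom)
    (τ := (Mero.shift (c + d)).toRingHom) fun a => ?_) m
  change Mero.shift c (Mero.shift d _) = Mero.shift (c + d) _
  simp only [Mero.shift_algebraMap]
  refine congrArg (algebraMap _ _) (Subtype.ext (funext fun x => ?_))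
  simp [Entire.shift, add_assoc]

theorem Mero.shift_zero {E : Type} [NormedAddCommGroup E] [NormedSpace ℂ E]
    (m : Mero E) : Mero.shift (0 : E) m = m := by
  refine DFunLike.congr_fun (Mero.ringHom_ext (σ := (Mero.shift (0 : E)).toRingHom)
    (τ := RingHom.id _) fun a => ?_) m
  change Mero.shift (0 : E) _ = _
  rw [Mero.shift_algebraMap]
  refine congrArg (algebraMap _ _) (Subtype.ext (funext fun x => ?_))
  simp [Entire.shift]

theorem Mero.compAlgHom_shift {E F : Type} [NormedAddCommGroup E] [NormedSpace ℂ E]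
    [NormedAddCommGroup F] [NormedSpace ℂ F] (L : E →L[ℂ] F) (hL : Function.Surjective L)
    (c : E) (m : Mero F) :
    Mero.compAlgHom L hL (Mero.shift (L c) m) = Mero.shift c (Mero.compAlgHom L hL m) := by
  refine DFunLike.congr_fun (Mero.ringHom_ext
    (σ := ((Mero.compAlgHom L hL).comp (Mero.shift (L c))).toRingHom)
    (τ := ((Mero.shift c).comp (Mero.compAlgHom L hL)).toRingHom) fun a => ?_) m
  change Mero.compAlgHom L hL (Mero.shift (L c) _) = Mero.shift c (Mero.compAlgHom L hL _)
  simp only [Mero.shift_algebraMap, Mero.compAlgHom_algebraMap]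
  refine congrArg (algebraMap _ _) (Subtype.ext (funext fun x => ?_))
  simp [Entire.shift, Entire.comp]

theorem AdmitsAAT.algebraicIndependent_real {n : ℕ} {f : Fin n → Mero (Cn n)} (hf : AdmitsAAT f) :
    AlgebraicIndependent ℝ f :=
  hf.algebraicIndependent.restrictScalars (K := ℂ) (algebraMap ℝ ℂ).injective

/-- Composition with an invertible real matrix, as a homomorphism of real algebras. -/
def Mero.compMatrix {n : ℕ} (α : Matrix.GeneralLinearGroup (Fin n) ℝ) :
    Mero (Cn n) →ₐ[ℝ] Mero (Cn n) :=
  Mero.compAlgHom (complexify α) (complexify_surjective α)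

theorem compGL_eq {n : ℕ} (g : Fin n → Mero (Cn n)) (α : Matrix.GeneralLinearGroup (Fin n) ℝ) :
    compGL g α = fun i => Mero.compMatrix α (g i) :=
  rfl

theorem compGL_compGL_inv {n : ℕ} (g : Fin n → Mero (Cn n))
    (α : Matrix.GeneralLinearGroup (Fin n) ℝ) : compGL (compGL g α) α⁻¹ = g := by
  funext i
  refine DFunLike.congr_fun (Mero.ringHom_ext
    (σ := ((Mero.compAlgHom (complexify α⁻¹) (complexify_surjective α⁻¹)).comp
      (Mero.compAlgHom (complexify α) (complexify_surjective α))).toRingHom)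
    (τ := RingHom.id _) fun a => ?_) (g i)
  change Mero.compAlgHom (complexify α⁻¹) (complexify_surjective α⁻¹)
    (Mero.compAlgHom (complexify α) (complexify_surjective α) _) = _
  simp only [Mero.compAlgHom_algebraMap]
  refine congrArg (algebraMap _ _) (Subtype.ext (funext fun x => ?_))
  simp only [Entire.comp]
  change (a : Cn n → ℂ) (complexify α (complexify α⁻¹ x)) = (a : Cn n → ℂ) x
  simp only [complexify, LinearMap.coe_toContinuousLinearMap', Matrix.mulVecLin_apply,
    Matrix.mulVec_mulVec]
  rw [← Matrix.map_mul, ← Units.val_mul, mul_inv_cancel]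
  simp

/-- The linear automorphism of `ℝ^n` given by an invertible matrix. -/
def realify {n : ℕ} (α : Matrix.GeneralLinearGroup (Fin n) ℝ) : Rn n →L[ℝ] Rn n :=
  LinearMap.toContinuousLinearMap (Matrix.mulVecLin (α : Matrix (Fin n) (Fin n) ℝ))

theorem realify_realify_inv {n : ℕ} (α : Matrix.GeneralLinearGroup (Fin n) ℝ) (x : Rn n) :
    realify α (realify α⁻¹ x) = x := by
  simp only [realify, LinearMap.coe_toContinuousLinearMap', Matrix.mulVecLin_apply,
    Matrix.mulVec_mulVec]
  rw [← Units.val_mul, mul_inv_cancel]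
  simp

theorem realify_inv_realify {n : ℕ} (α : Matrix.GeneralLinearGroup (Fin n) ℝ) (x : Rn n) :
    realify α⁻¹ (realify α x) = x := by
  simpa using realify_realify_inv α⁻¹ x

theorem complexify_toCn {n : ℕ} (α : Matrix.GeneralLinearGroup (Fin n) ℝ) (x : Rn n) :
    complexify α (toCn x) = toCn (realify α x) := by
  funext i
  simp [complexify, realify, toCn, Matrix.mulVec, dotProduct]

theorem toCn_add {n : ℕ} (x y : Rn n) : toCn (x + y) = toCn x + toCn y := by
  funext i
  simp [toCn]

/-! ### Identity theorem -/

/-- The one-variable identity theorem is used twice: on real lines through a point of `W`, giving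
zero on `ℝ^n`, and then on `t ↦ Re z + t Im z`, which is real for real `t` and equals `z` at `t =
i`. -/
theorem Entire.eq_zero_of_eqOn_real {n : ℕ} (a : Entire (Cn n)) {W : Set (Rn n)} (hW : IsOpen W)
    (hne : W.Nonempty) (h : ∀ u ∈ W, (a : Cn n → ℂ) (toCn u) = 0) : a = 0 := by
  have line : ∀ p q : Cn n, (∃ᶠ t : ℂ in 𝓝[≠] 0, (a : Cn n → ℂ) (p + t • q) = 0) →
      ∀ t : ℂ, (a : Cn n → ℂ) (p + t • q) = 0 := by
    intro p q hf t
    refine congrFun (AnalyticOnNhd.eq_of_frequently_eq (𝕜 := ℂ) (z₀ := 0)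
      (f := fun t => (a : Cn n → ℂ) (p + t • q)) (g := fun _ => 0) ?_ analyticOnNhd_const hf) t
    intro z _
    exact AnalyticAt.fun_comp (g := (a : Cn n → ℂ)) (a.2 _ (mem_univ _))
      (analyticAt_const.add (analyticAt_id.smul analyticAt_const))
  have freq : ∀ P : ℂ → Prop, (∀ᶠ t : ℝ in 𝓝 0, P t) → ∃ᶠ t : ℂ in 𝓝[≠] 0, P t := by
    intro P hP
    have ht : Filter.Tendsto (fun t : ℝ => (t : ℂ)) (𝓝[≠] 0) (𝓝[≠] 0) := by
      refine tendsto_nhdsWithin_of_tendsto_nhds_of_eventually_within _ ?_ ?_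
      · exact (Complex.continuous_ofReal.tendsto' 0 0 (by simp)).mono_left nhdsWithin_le_nhds
      · filter_upwards [self_mem_nhdsWithin] with t ht
        simpa using ht
    exact ht.frequently (Filter.Eventually.frequently (hP.filter_mono nhdsWithin_le_nhds))
  obtain ⟨x₀, hx₀⟩ := hne
  have hreal : ∀ x : Rn n, (a : Cn n → ℂ) (toCn x) = 0 := by
    intro x
    have := line (toCn x₀) (toCn (x - x₀)) (freq _ ?_) 1
    · rw [one_smul, ← toCn_add] at this
      simpa using this
    · have hc : Filter.Tendsto (fun t : ℝ => x₀ + t • (x - x₀)) (𝓝 0) (𝓝 x₀) :=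
        Continuous.tendsto' (by fun_prop) _ _ (by simp)
      filter_upwards [hc.eventually (hW.mem_nhds hx₀)] with t ht
      rw [← h _ ht]
      refine congrArg (a : Cn n → ℂ) (funext fun i => ?_)
      simp [toCn]
  refine Subtype.ext (funext fun z => ?_)
  have := line (toCn fun i => (z i).re) (toCn fun i => (z i).im) (freq _ ?_) Complex.I
  · change (a : Cn n → ℂ) z = 0
    rw [← this]
    refine congrArg (a : Cn n → ℂ) (funext fun i => ?_)
    simp only [toCn, Pi.add_apply, Pi.smul_apply, smul_eq_mul]
    rw [mul_comm, Complex.re_add_im]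
  · refine Filter.Eventually.of_forall fun t => ?_
    rw [← hreal ((fun i => (z i).re) + t • fun i => (z i).im)]
    refine congrArg (a : Cn n → ℂ) (funext fun i => ?_)
    simp [toCn]

/-! ### Real functions representing meromorphic functions -/

/-- The pairs of a meromorphic function `a / b` and a real function `y` such that `b y = a` on
`W ⊆ ℝ^n`. -/
def representations {n : ℕ} (W : Set (Rn n)) : Subalgebra ℝ (Mero (Cn n) × (Rn n → ℝ)) where
  carrier := {p | ∃ a b : Entire (Cn n), b ≠ 0 ∧
    p.1 * algebraMap (Entire (Cn n)) (Mero (Cn n)) b =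
      algebraMap (Entire (Cn n)) (Mero (Cn n)) a ∧
    ∀ u ∈ W, (b : Cn n → ℂ) (toCn u) * (p.2 u : ℂ) = (a : Cn n → ℂ) (toCn u)}
  mul_mem' := by
    rintro ⟨m, y⟩ ⟨m', y'⟩ ⟨a, b, hb, h, hu⟩ ⟨a', b', hb', h', hu'⟩
    refine ⟨a * a', b * b', mul_ne_zero hb hb', ?_, fun u hW => ?_⟩
    · simp only [Prod.mk_mul_mk, map_mul, ← h, ← h']
      ring
    · simp only [Prod.mk_mul_mk, Subalgebra.coe_mul, Pi.mul_apply, Complex.ofReal_mul, ← hu u hW,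
        ← hu' u hW]
      ring
  add_mem' := by
    rintro ⟨m, y⟩ ⟨m', y'⟩ ⟨a, b, hb, h, hu⟩ ⟨a', b', hb', h', hu'⟩
    refine ⟨a * b' + b * a', b * b', mul_ne_zero hb hb', ?_, fun u hW => ?_⟩
    · simp only [Prod.mk_add_mk, map_mul, map_add, ← h, ← h']
      ring
    · simp only [Prod.mk_add_mk, Subalgebra.coe_mul, Subalgebra.coe_add, Pi.mul_apply,
        Pi.add_apply, Complex.ofReal_add, ← hu u hW, ← hu' u hW]
      ring
  algebraMap_mem' r := by
    refine ⟨algebraMap ℝ _ r, 1, one_ne_zero, ?_, fun u _ => ?_⟩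
    · rw [map_one, mul_one, ← IsScalarTower.algebraMap_apply]
      rfl
    · change (1 : ℂ) * (r : ℂ) = (r : ℂ)
      simp

namespace representations

variable {n : ℕ} {W : Set (Rn n)} {m : Mero (Cn n)} {y : Rn n → ℝ}

theorem mono {W' : Set (Rn n)} (h : (m, y) ∈ representations W) (hW : W' ⊆ W) :
    (m, y) ∈ representations W' := by
  obtain ⟨a, b, hb, hm, hu⟩ := h
  exact ⟨a, b, hb, hm, fun u h => hu u (hW h)⟩

theorem congr {y' : Rn n → ℝ} (h : (m, y) ∈ representations W) (hy : ∀ u ∈ W, y u = y' u) :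
    (m, y') ∈ representations W := by
  obtain ⟨a, b, hb, hm, hu⟩ := h
  exact ⟨a, b, hb, hm, fun u h => by simpa [← hy u h] using hu u h⟩

theorem shift (h : (m, y) ∈ representations W) (c : Rn n) :
    (Mero.shift (toCn c) m, fun u => y (u + c)) ∈ representations ((· + c) ⁻¹' W) := by
  obtain ⟨a, b, hb, hm, hu⟩ := h
  refine ⟨Entire.shift (toCn c) a, Entire.shift (toCn c) b,
    (map_ne_zero_iff _ (Entire.shift_injective _)).2 hb, ?_, fun u h => ?_⟩
  · simp only [← Mero.shift_algebraMap, ← map_mul]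
    exact congrArg _ hm
  · have := hu _ h
    rw [toCn_add] at this
    exact this

theorem comp (h : (m, y) ∈ representations W) (α : Matrix.GeneralLinearGroup (Fin n) ℝ) :
    (Mero.compMatrix α m, fun u => y (realify α u)) ∈
      representations (realify α ⁻¹' W) := by
  obtain ⟨a, b, hb, hm, hu⟩ := h
  refine ⟨Entire.comp (complexify α) a, Entire.comp (complexify α) b,
    (map_ne_zero_iff _ (Entire.comp_injective _ (complexify_surjective α))).2 hb, ?_,
    fun u h => ?_⟩
  · simp only [Mero.compMatrix, ← Mero.compAlgHom_algebraMap (complexify α) (complexify_surjective α), ← map_mul]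
    exact congrArg _ hm
  · have := hu _ h
    rw [← complexify_toCn] at this
    exact this

theorem eq_zero (h : (m, y) ∈ representations W) (hW : IsOpen W) (hne : W.Nonempty)
    (hy : ∀ u ∈ W, y u = 0) : m = 0 := by
  obtain ⟨a, b, hb, hm, hu⟩ := h
  have ha : a = 0 := Entire.eq_zero_of_eqOn_real a hW hne fun u h => by simp [← hu u h, hy u h]
  rw [ha, map_zero, mul_eq_zero] at hm
  exact hm.resolve_right fun h0 =>
    hb ((map_eq_zero_iff _ (IsFractionRing.injective (Entire (Cn n)) (Mero (Cn n)))).1 h0)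

/-- Continuity is needed because `b y = a` says nothing about `y` at zeros of `b`. If `y` were
nonzero at a point, it would be so on an open set, and `b` would vanish there. -/
theorem eqOn_zero (h : ((0 : Mero (Cn n)), y) ∈ representations W) (hW : IsOpen W)
    (hy : ContinuousOn y W) {u : Rn n} (hu : u ∈ W) : y u = 0 := by
  obtain ⟨a, b, hb, hm, hab⟩ := h
  have ha : a = 0 := by
    rw [zero_mul] at hm
    exact (map_eq_zero_iff _ (IsFractionRing.injective (Entire (Cn n)) (Mero (Cn n)))).1 hm.symm
  by_contra hne
  obtain ⟨V, hVW, hV, huV⟩ := mem_nhds_iff.1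
    (Filter.inter_mem ((hy.continuousAt (hW.mem_nhds hu)).eventually_ne hne) (hW.mem_nhds hu))
  refine hb (Entire.eq_zero_of_eqOn_real b hV ⟨u, huV⟩ fun v hv => ?_)
  have := hab v (hVW hv).2
  rw [ha] at this
  refine (mul_eq_zero.1 this).resolve_right ?_
  exact_mod_cast (hVW hv).1

theorem aeval {ι : Type} {f : ι → Mero (Cn n)} {φ : ι → Rn n → ℝ}
    (h : ∀ i, (f i, φ i) ∈ representations W) (P : MvPolynomial ι ℝ) :
    (MvPolynomial.aeval f P, fun u => MvPolynomial.eval (fun i => φ i u) P) ∈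
      representations W := by
  have key : (MvPolynomial.aeval f P, fun u => MvPolynomial.eval (fun i => φ i u) P) =
      MvPolynomial.aeval (fun i => (f i, φ i)) P := by
    induction P using MvPolynomial.induction_on with
    | C a => ext <;> simp
    | add p q hp hq =>
      rw [map_add (MvPolynomial.aeval (R := ℝ) fun i => (f i, φ i)) p q, ← hp, ← hq]
      ext <;> simp
    | mul_X p i hp =>
      rw [map_mul (MvPolynomial.aeval (R := ℝ) fun i => (f i, φ i)) p, ← hp]
      ext <;> simp
  have hval : (representations W).val
      (MvPolynomial.aeval (fun i => (⟨(f i, φ i), h i⟩ : representations W)) P) =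
        MvPolynomial.aeval (fun i => (f i, φ i)) P :=
    MvPolynomial.comp_aeval_apply _ _ P
  rw [key, ← hval]
  exact Subtype.property _

end representations

/-! ### Semialgebraic sets -/

namespace IsSemialgebraic

variable {ι κ : Type}

theorem inter {s t : Set (ι → ℝ)} (hs : IsSemialgebraic s) (ht : IsSemialgebraic t) :
    IsSemialgebraic (s ∩ t) := by
  have := (hs.compl.union ht.compl).compl
  rwa [compl_union, compl_compl, compl_compl] at this

theorem setOf_eval_eq_zero (p : MvPolynomial ι ℝ) :
    IsSemialgebraic {x | MvPolynomial.eval x p = 0} := by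
  have := ((pos p).union (pos (-p))).compl
  convert! this using 1
  ext x
  simp only [mem_ofPred_eq, mem_compl_iff, mem_union, map_neg, not_or, not_lt]
  constructor
  · intro h; simp [h]
  · rintro ⟨h1, h2⟩; linarith

theorem preimage_coords {s : Set (ι → ℝ)} (hs : IsSemialgebraic s) (σ : ι → κ) :
    IsSemialgebraic {z : κ → ℝ | (fun i => z (σ i)) ∈ s} := by
  induction hs with
  | pos p =>
    convert! pos (MvPolynomial.rename σ p) using 1
    ext z
    simp [MvPolynomial.eval_rename, Function.comp_def]
  | compl _ ih => exact ih.compl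
  | union _ _ ih₁ ih₂ => exact ih₁.union ih₂

/-- The frontier of a semialgebraic set is contained in a proper algebraic subset. -/
theorem exists_frontier_subset {s : Set (ι → ℝ)} (hs : IsSemialgebraic s) :
    ∃ Q : MvPolynomial ι ℝ, Q ≠ 0 ∧ frontier s ⊆ {x | MvPolynomial.eval x Q = 0} := by
  induction hs with
  | pos p =>
    by_cases hp : p = 0
    · exact ⟨1, one_ne_zero, by simp [hp]⟩
    · refine ⟨p, hp, fun x hx => ?_⟩
      exact (frontier_lt_subset_eq continuous_const (MvPolynomial.continuous_eval p) hx).symm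
  | compl _ ih =>
    obtain ⟨Q, hQ, h⟩ := ih
    exact ⟨Q, hQ, by rwa [frontier_compl]⟩
  | @union s t _ _ ih₁ ih₂ =>
    obtain ⟨Q, hQ, h⟩ := ih₁
    obtain ⟨R, hR, h'⟩ := ih₂
    refine ⟨Q * R, mul_ne_zero hQ hR, fun x hx => ?_⟩
    rcases frontier_union_subset s t hx with hx | hx
    · have := h hx.1
      simp_all
    · have := h' hx.2
      simp_all

/-- A semialgebraic function satisfies a polynomial equation. -/
theorem exists_eval_graph_eq_zero {U : Set (ι → ℝ)} {h : (ι → ℝ) → ℝ}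
    (hs : IsSemialgebraic (graphOver U h)) :
    ∃ Q : MvPolynomial (Option ι) ℝ, Q ≠ 0 ∧
      ∀ x ∈ U, MvPolynomial.eval (fun o => o.elim (h x) x) Q = 0 := by
  classical
  obtain ⟨Q, hQ, hfr⟩ := hs.exists_frontier_subset
  refine ⟨Q, hQ, fun x hx => hfr ⟨subset_closure ⟨hx, rfl⟩, fun hint => ?_⟩⟩
  let z : Option ι → ℝ := fun o => o.elim (h x) x
  -- Moving only the value coordinate leaves the graph at once, so no point of the graph is
  -- interior.
  have hc : Filter.Tendsto (fun t : ℝ => Function.update z none (h x + t)) (𝓝[≠] 0) (𝓝 z) := by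
    refine (Continuous.tendsto' ?_ 0 z ?_).mono_left nhdsWithin_le_nhds
    · exact continuous_const.update none (by fun_prop)
    · simp [z]
  obtain ⟨t, ht, ht0⟩ :=
    ((hc.eventually (mem_interior_iff_mem_nhds.1 hint)).and self_mem_nhdsWithin).exists
  have ht' := ht.2
  simp [z] at ht'
  exact ht0 ht'

/-- Every point has arbitrarily small open semialgebraic neighbourhoods. -/
theorem exists_open_nhds [Fintype ι] {x : ι → ℝ} {s : Set (ι → ℝ)} (hs : s ∈ 𝓝 x) :
    ∃ V ⊆ s, IsOpen V ∧ x ∈ V ∧ IsSemialgebraic V := by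
  obtain ⟨ε, hε, hball⟩ := Metric.mem_nhds_iff.1 hs
  -- The Euclidean ball of radius `ε`, contained in the sup-norm ball.
  let q : MvPolynomial ι ℝ :=
    MvPolynomial.C (ε ^ 2) - ∑ i, (MvPolynomial.X i - MvPolynomial.C (x i)) ^ 2
  refine ⟨{y | 0 < MvPolynomial.eval y q}, fun y hy => hball ?_,
    isOpen_lt continuous_const (MvPolynomial.continuous_eval q), ?_, pos q⟩
  · simp only [q, map_sub, map_sum, map_pow, MvPolynomial.eval_C, MvPolynomial.eval_X,
      mem_ofPred_eq, sub_pos] at hy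
    rw [Metric.mem_ball, dist_pi_lt_iff hε]
    intro i
    rw [Real.dist_eq]
    refine abs_lt_of_sq_lt_sq (lt_of_le_of_lt ?_ hy) hε.le
    exact Finset.single_le_sum (f := fun i => (y i - x i) ^ 2) (fun j _ => sq_nonneg _)
      (Finset.mem_univ i)
  · simp [q, sq_pos_of_pos hε]

end IsSemialgebraic

/-- A continuous solution `h` of a polynomial equation is semialgebraic near every point where the
derivative of the equation in the last variable does not vanish. -/
theorem exists_nhds_isSemialgebraic_graphOver {ι : Type} [Fintype ι]
    {h : (ι → ℝ) → ℝ} {x₀ : ι → ℝ} {p : Polynomial (MvPolynomial ι ℝ)}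
    (hc : ContinuousAt h x₀)
    (hp : ∀ᶠ x in 𝓝 x₀, (p.map (MvPolynomial.eval x)).eval (h x) = 0)
    (hd : (p.derivative.map (MvPolynomial.eval x₀)).eval (h x₀) ≠ 0) :
    ∀ᶠ V in (𝓝 x₀).smallSets, IsSemialgebraic V → IsSemialgebraic (graphOver V h) := by
  let G : (ι → ℝ) × ℝ → ℝ := fun z => (p.derivative.map (MvPolynomial.eval z.1)).eval z.2
  have hG : Continuous G := by
    have : G = fun z => MvPolynomial.eval (fun o : Option ι => o.elim z.2 z.1)
        ((MvPolynomial.optionEquivLeft ℝ ι).symm p.derivative) := by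
      funext z
      rw [MvPolynomial.optionEquivLeft_elim_eval, AlgEquiv.apply_symm_apply]
    rw [this]
    refine (MvPolynomial.continuous_eval _).comp (continuous_pi fun o => ?_)
    cases o
    · exact continuous_snd
    · exact (continuous_apply _).comp continuous_fst
  have hev : ∀ᶠ z in 𝓝 x₀ ×ˢ 𝓝 (h x₀), G z ≠ 0 := by
    rw [← nhds_prod_eq]
    exact hG.continuousAt.eventually_ne hd
  obtain ⟨P, hP, R, hR, hPR⟩ := Filter.eventually_prod_iff.1 hev
  obtain ⟨ε, hε, hball⟩ := Metric.eventually_nhds_iff.1 hR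
  have hI : ∀ᶠ x in 𝓝 x₀, |h x - h x₀| < ε := hc.eventually (Metric.ball_mem_nhds _ hε)
  rw [Filter.eventually_smallSets]
  refine ⟨_, hP.and (hp.and hI), fun V hV hVs => ?_⟩
  let Q := (MvPolynomial.optionEquivLeft ℝ ι).symm p
  let B : MvPolynomial (Option ι) ℝ :=
    MvPolynomial.C (ε ^ 2) - (MvPolynomial.X none - MvPolynomial.C (h x₀)) ^ 2
  have hQ : ∀ z : Option ι → ℝ, MvPolynomial.eval z Q =
      (p.map (MvPolynomial.eval fun i => z (some i))).eval (z none) := by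
    intro z
    have := MvPolynomial.optionEquivLeft_elim_eval ℝ _ (fun i => z (some i)) (z none) Q
    rw [AlgEquiv.apply_symm_apply] at this
    rw [← this]
    congr 2
    funext o
    cases o <;> rfl
  have hB : ∀ z : Option ι → ℝ, 0 < MvPolynomial.eval z B ↔ |z none - h x₀| < ε := by
    intro z
    simp only [B, map_sub, map_pow, MvPolynomial.eval_C, MvPolynomial.eval_X, sub_pos]
    rw [sq_lt_sq, abs_of_pos hε]
  -- Over `V`, the graph is the zero set of `Q` inside the strip `|y - h x₀| < ε`. The derivative
  -- has no zero in this strip, which excludes a second root.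
  convert! ((hVs.preimage_coords (κ := Option ι) some).inter
    ((IsSemialgebraic.pos B).inter (IsSemialgebraic.setOf_eval_eq_zero Q))) using 1
  ext z
  simp only [graphOver, mem_ofPred_eq, mem_inter_iff, hB, hQ]
  refine and_congr_right fun hz => ?_
  obtain ⟨hPz, hpz, hIz⟩ := hV hz
  constructor
  · intro h1
    rw [h1]
    exact ⟨hIz, hpz⟩
  · rintro ⟨h1, h2⟩
    by_contra hne
    -- Rolle's theorem on the interval between the two roots
    let r := p.map (MvPolynomial.eval fun i => z (some i))
    have hr : ∀ a b : ℝ, a < b → |a - h x₀| < ε → |b - h x₀| < ε → r.eval a = 0 →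
        r.eval b = 0 → False := by
      intro a b hab ha hb h0 h0'
      obtain ⟨c, hc, hc0⟩ := exists_hasDerivAt_eq_zero (f := fun y => r.eval y) hab
        r.continuous.continuousOn (h0.trans h0'.symm) fun y _ => r.hasDerivAt y
      have hcε : dist c (h x₀) < ε := by
        rw [Real.dist_eq, abs_lt] at *
        constructor <;> linarith [hc.1, hc.2, ha.1, ha.2, hb.1, hb.2]
      refine hPR hPz (hball hcε) ?_
      simpa [G, r, Polynomial.derivative_map] using hc0
    rcases lt_or_gt_of_ne hne with hlt | hlt
    · exact hr _ _ hlt h1 hIz h2 hpz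
    · exact hr _ _ hlt hIz h1 hpz h2

/-! ### Nash maps and algebraic dependence -/

theorem IsNashOn.isAlgebraicOver {n : ℕ} {ι : Type} [Fintype ι] {f : Fin n → Mero (Cn n)}
    (hf : AlgebraicIndependent ℝ f) {g : ι → Mero (Cn n)} {U : Set (Rn n)} (hU : IsOpen U)
    (hne : U.Nonempty) {e : Rn n → Rn n} {h : Rn n → ι → ℝ} (hN : IsNashOn h (e '' U))
    (he : ∀ i, (f i, fun u => e u i) ∈ representations U)
    (hg : ∀ i, (g i, fun u => h (e u) i) ∈ representations U) : IsAlgebraicOver ℝ g f := by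
  rw [IsAlgebraicOver.iff_not_algebraicIndependent hf]
  intro i hind
  obtain ⟨Q, hQ, hz⟩ := (hN.semialgebraic i).exists_eval_graph_eq_zero
  refine hQ ((algebraicIndependent_iff.1 hind) Q ?_)
  have hrep := representations.aeval (W := U) (f := fun o : Option (Fin n) => o.elim (g i) f)
    (φ := fun o => o.elim (fun u => h (e u) i) fun j u => e u j)
    (fun o => by cases o; exacts [hg i, he _]) Q
  refine representations.eq_zero hrep hU hne fun u hu => ?_
  rw [← hz (e u) (mem_image_of_mem e hu)]
  congr 2
  funext o
  cases o <;> rfl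

/-- If `g` is algebraic over `ℝ(f)`, then near a suitable point the function represented by `g` is
a semialgebraic function of the one represented by `f`. -/
theorem exists_nash_of_isAlgebraicOver {n : ℕ} {ι : Type} [Fintype ι] {f : Fin n → Mero (Cn n)}
    (hf : AlgebraicIndependent ℝ f) {g : ι → Mero (Cn n)} (hg : IsAlgebraicOver ℝ g f)
    (e : OpenPartialHomeomorph (Rn n) (Rn n)) {h : Rn n → ι → ℝ} {W : Set (Rn n)}
    (hW : IsOpen W) (hne : W.Nonempty) (hWe : W ⊆ e.source)
    (hh : ∀ i, AnalyticOnNhd ℝ (fun x => h x i) (e '' W))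
    (hef : ∀ i, (f i, fun u => e u i) ∈ representations W)
    (heg : ∀ i, (g i, fun u => h (e u) i) ∈ representations W) :
    ∃ u ∈ W, ∃ V, IsOpen V ∧ u ∈ V ∧ V ⊆ W ∧ IsNashOn h (e '' V) := by
  rw [IsAlgebraicOver.iff_not_algebraicIndependent hf] at hg
  choose p hp hd using fun i => exists_eval₂_eq_zero_derivative_ne_zero hf (hg i)
  have heW : IsOpen (e '' W) := e.isOpen_image_of_subset_source hW hWe
  have hcont : ∀ i, ContinuousOn (fun u => h (e u) i) W := fun i =>
    (hh i).continuousOn.comp (e.continuousOn.mono hWe) (mapsTo_image e W)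
  have hrep : ∀ (q : Polynomial (MvPolynomial (Fin n) ℝ)) (i : ι),
      (q.eval₂ (MvPolynomial.aeval f : MvPolynomial (Fin n) ℝ →ₐ[ℝ] Mero (Cn n)).toRingHom (g i),
        fun u => (q.map (MvPolynomial.eval (e u))).eval (h (e u) i)) ∈ representations W := by
    intro q i
    have := representations.aeval (W := W) (f := fun o : Option (Fin n) => o.elim (g i) f)
      (φ := fun o => o.elim (fun u => h (e u) i) fun j u => e u j)
      (fun o => by cases o; exacts [heg i, hef _]) ((MvPolynomial.optionEquivLeft ℝ _).symm q)
    rw [MvPolynomial.aeval_option_elim, AlgEquiv.apply_symm_apply] at this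
    convert! this using 2
    funext u
    have h2 := MvPolynomial.optionEquivLeft_elim_eval ℝ _ (e u) (h (e u) i)
      ((MvPolynomial.optionEquivLeft ℝ _).symm q)
    rw [AlgEquiv.apply_symm_apply] at h2
    rw [← h2]
    congr 2
    funext o
    cases o <;> rfl
  have hcontq : ∀ (q : Polynomial (MvPolynomial (Fin n) ℝ)) (i : ι),
      ContinuousOn (fun u => (q.map (MvPolynomial.eval (e u))).eval (h (e u) i)) W := by
    intro q i
    have : ContinuousOn (fun u => MvPolynomial.eval
        (fun o : Option (Fin n) => o.elim (h (e u) i) (e u))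
        ((MvPolynomial.optionEquivLeft ℝ _).symm q)) W := by
      refine (MvPolynomial.continuous_eval _).comp_continuousOn (continuousOn_pi.2 fun o => ?_)
      cases o
      · exact hcont i
      · exact (continuous_apply _).comp_continuousOn (e.continuousOn.mono hWe)
    refine this.congr fun u _ => ?_
    beta_reduce
    rw [MvPolynomial.optionEquivLeft_elim_eval, AlgEquiv.apply_symm_apply]
  have hpz : ∀ i, ∀ u ∈ W, ((p i).map (MvPolynomial.eval (e u))).eval (h (e u) i) = 0 := by
    intro i u hu
    have := hrep (p i) i
    rw [hp i] at this
    exact representations.eqOn_zero this hW (hcontq _ _) hu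
  -- The product of the derivatives is a nonzero meromorphic function, so at some point of `W` all
  -- of them are nonzero simultaneously.
  have hprod := (representations W).prod_mem (t := Finset.univ)
    fun i _ => hrep (p i).derivative i
  obtain ⟨u, hu, hud⟩ : ∃ u ∈ W, ∀ i,
      ((p i).derivative.map (MvPolynomial.eval (e u))).eval (h (e u) i) ≠ 0 := by
    by_contra! hcon
    have h0 := representations.eq_zero (m := Prod.fst (∏ i, _)) (y := Prod.snd (∏ i, _)) hprod hW hne
      fun u hu => by
        obtain ⟨i, hi⟩ := hcon u hu
        rw [Prod.snd_prod, Finset.prod_apply]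
        exact Finset.prod_eq_zero (Finset.mem_univ i) hi
    rw [Prod.fst_prod, Finset.prod_eq_zero_iff] at h0
    obtain ⟨i, _, hi⟩ := h0
    exact hd i hi
  have hx : e u ∈ e '' W := mem_image_of_mem e hu
  -- Working with all small `V` allows one neighbourhood to serve all coordinates.
  have hsa : ∀ᶠ V in (𝓝 (e u)).smallSets, ∀ i,
      IsSemialgebraic V → IsSemialgebraic (graphOver V fun x => h x i) := by
    refine Filter.eventually_all.2 fun i => ?_
    refine exists_nhds_isSemialgebraic_graphOver (p := p i) ((hh i) _ hx).continuousAt ?_ (hud i)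
    filter_upwards [heW.mem_nhds hx]
    rintro _ ⟨v, hv, rfl⟩
    exact hpz i v hv
  obtain ⟨s, hs, hs'⟩ := Filter.eventually_smallSets.1 hsa
  obtain ⟨V, hVs, hVo, hxV, hVsa⟩ :=
    IsSemialgebraic.exists_open_nhds (Filter.inter_mem hs (heW.mem_nhds hx))
  have hVW : V ⊆ e '' W := fun x hx => (hVs hx).2
  have himg : e '' (W ∩ e ⁻¹' V) = V := by
    rw [image_inter_preimage, inter_eq_right.2 hVW]
  refine ⟨u, hu, W ∩ e ⁻¹' V, (e.continuousOn.mono hWe).isOpen_inter_preimage hW hVo,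
    ⟨hu, hxV⟩, inter_subset_left, ?_⟩
  rw [himg]
  exact ⟨hVo, hVsa, fun i => (hh i).mono hVW, fun i => hs' V (fun x hx => (hVs hx).1) i hVsa⟩

/-! ### The charts of `(ℝ^n, +, f)` -/

theorem IsChartOf.exists_representations {n : ℕ} {f : Fin n → Mero (Cn n)}
    {φ : OpenPartialHomeomorph (Rn n) (Rn n)} (h : IsChartOf f φ) :
    ∃ k : Rn n, ∀ i, (Mero.shift (toCn k) (f i), fun u => φ u i) ∈ representations φ.source := by
  obtain ⟨k, hk⟩ := h.eq_translate
  refine ⟨k, fun i => ?_⟩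
  obtain ⟨a, b, hb, hab⟩ := IsFractionRing.div_surjective (A := Entire (Cn n)) (f i)
  have hb0 : b ≠ 0 := nonZeroDivisors.ne_zero hb
  have hfb : f i * algebraMap (Entire (Cn n)) (Mero (Cn n)) b =
      algebraMap (Entire (Cn n)) (Mero (Cn n)) a := by
    rw [← hab, div_mul_cancel₀]
    exact (map_ne_zero_iff _ (IsFractionRing.injective (Entire (Cn n)) (Mero (Cn n)))).2 hb0
  refine ⟨Entire.shift (toCn k) a, Entire.shift (toCn k) b,
    (map_ne_zero_iff _ (Entire.shift_injective _)).2 hb0, ?_, fun u hu => ?_⟩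
  · simp only [← Mero.shift_algebraMap, ← map_mul]
    exact congrArg _ hfb
  · have := hk i a b hfb u hu
    rw [toCn_add] at this
    exact this

/-- The translate of a chart. -/
abbrev translateChart {n : ℕ} (φ : OpenPartialHomeomorph (Rn n) (Rn n)) (a : Rn n) :
    OpenPartialHomeomorph (Rn n) (Rn n) :=
  (Homeomorph.addLeft (-a)).transOpenPartialHomeomorph φ

theorem translateChart_representations {n : ℕ} {f : Fin n → Mero (Cn n)}
    {φ : OpenPartialHomeomorph (Rn n) (Rn n)} {k : Rn n}
    (h : ∀ i, (Mero.shift (toCn k) (f i), fun u => φ u i) ∈ representations φ.source)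
    (a : Rn n) (i : Fin n) :
    (Mero.shift (toCn (-a + k)) (f i), fun u => translateChart φ a u i) ∈
      representations (translateChart φ a).source := by
  have := representations.shift (h i) (-a)
  rw [Mero.shift_shift, ← toCn_add] at this
  refine representations.congr (representations.mono this fun u hu => ?_) fun u _ => ?_
  · simpa [add_comm] using hu
  · simp [add_comm]

theorem Mero.shift_cancel {n : ℕ} (c : Rn n) (m : Mero (Cn n)) :
    Mero.shift (toCn (-c)) (Mero.shift (toCn c) m) = m := by
  rw [Mero.shift_shift, ← toCn_add, neg_add_cancel]
  have : toCn (0 : Rn n) = 0 := by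
    funext i
    simp [toCn]
  rw [this, Mero.shift_zero]

theorem AlgebraicIndependent.shift {n : ℕ} {f : Fin n → Mero (Cn n)}
    (hf : AlgebraicIndependent ℝ f) (c : Rn n) :
    AlgebraicIndependent ℝ fun i => Mero.shift (toCn c) (f i) :=
  hf.map' (f := Mero.shift (toCn c)) (Mero.shift (toCn c)).toRingHom.injective

theorem AlgebraicIndependent.compGL {n : ℕ} {f : Fin n → Mero (Cn n)}
    (hf : AlgebraicIndependent ℝ f) (α : Matrix.GeneralLinearGroup (Fin n) ℝ) :
    AlgebraicIndependent ℝ (_root_.compGL f α) := by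
  rw [compGL_eq]
  exact hf.map' (f := Mero.compMatrix α)
    (Mero.compMatrix α).toRingHom.injective

theorem IsAlgebraicOver.compGL {n : ℕ} {f g : Fin n → Mero (Cn n)}
    (h : IsAlgebraicOver ℝ g f) (α : Matrix.GeneralLinearGroup (Fin n) ℝ) :
    IsAlgebraicOver ℝ (_root_.compGL g α) (_root_.compGL f α) := by
  rw [compGL_eq, compGL_eq]
  exact h.map (Mero.compMatrix α)

/-- In `(ℝ^n, +, f)`, the translates of `f` are algebraic over `ℝ(f)`, because the changes of charts
are Nash maps. -/
theorem IsStructureOf.isAlgebraicOver_shift {n : ℕ} {f : Fin n → Mero (Cn n)}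
    {A : Set (OpenPartialHomeomorph (Rn n) (Rn n))} (hA : IsStructureOf f A)
    (hf : AlgebraicIndependent ℝ f) (c : Rn n) :
    IsAlgebraicOver ℝ (fun i => Mero.shift (toCn c) (f i)) f := by
  obtain ⟨hG, φ, hφ, rfl⟩ := hA
  obtain ⟨k, hk⟩ := hφ.exists_representations
  have near : ∀ a ∈ φ.source, IsAlgebraicOver ℝ (fun i => Mero.shift (toCn (-a)) (f i)) f := by
    -- The charts at `0` and at `a` both contain `a`. Their coordinates are `f(u + k)` and `f(u - a
    -- + k)`; the common `k` is removed afterwards.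
    intro a ha
    have hN := hG.atlas.transition (translateChart φ 0) ⟨0, rfl⟩ (translateChart φ a) ⟨a, rfl⟩
    have hmem : a ∈ (translateChart φ 0).source ∩ (translateChart φ a).source := by
      simp [ha, hφ.zero_mem]
    have halg := hN.isAlgebraicOver (hf.shift (-0 + k))
      (g := fun i => Mero.shift (toCn (-a + k)) (f i))
      ((translateChart φ 0).open_source.inter (translateChart φ a).open_source) ⟨a, hmem⟩
      (fun i => representations.mono (translateChart_representations hk 0 i) inter_subset_left)
      (fun i => representations.congr
        (representations.mono (translateChart_representations hk a i) inter_subset_right)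
        fun u hu => by rw [(translateChart φ 0).left_inv hu.1])
    have := halg.map (Mero.shift (toCn (-k)))
    simp only [neg_zero, zero_add, Mero.shift_cancel] at this
    simp only [Mero.shift_shift, ← toCn_add] at this
    convert this using 5
    abel
  have add : ∀ c d : Rn n, IsAlgebraicOver ℝ (fun i => Mero.shift (toCn c) (f i)) f →
      IsAlgebraicOver ℝ (fun i => Mero.shift (toCn d) (f i)) f →
      IsAlgebraicOver ℝ (fun i => Mero.shift (toCn (c + d)) (f i)) f := by
    intro c d hc hd
    have := (hd.map (Mero.shift (toCn c))).trans hc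
    simpa only [Mero.shift_shift, ← toCn_add] using this
  have mul : ∀ (N : ℕ) (c : Rn n), IsAlgebraicOver ℝ (fun i => Mero.shift (toCn c) (f i)) f →
      IsAlgebraicOver ℝ (fun i => Mero.shift (toCn ((N + 1 : ℕ) • c)) (f i)) f := by
    intro N c hc
    induction N with
    | zero => simpa using hc
    | succ N ih =>
      rw [succ_nsmul]
      exact add _ _ ih hc
  -- Every `c` is `N + 1` times a translation small enough for `near`; the sign compensates the `-a`
  -- there.
  have ht : Filter.Tendsto (fun N : ℕ => (1 / ((N : ℝ) + 1)) • (-c)) Filter.atTop (𝓝 0) := by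
    have := (tendsto_one_div_add_atTop_nhds_zero_nat (𝕜 := ℝ)).smul_const (-c)
    rwa [zero_smul] at this
  obtain ⟨N, hN⟩ := (ht.eventually (φ.open_source.mem_nhds hφ.zero_mem)).exists
  have := mul N _ (near _ hN)
  convert this using 5
  rw [← Nat.cast_smul_eq_nsmul ℝ, smul_neg, smul_neg, smul_neg, neg_neg, smul_smul]
  push_cast
  rw [mul_one_div_cancel (by positivity), one_smul]

theorem IsStructureOf.isAlgebraicOver_self_shift {n : ℕ} {f : Fin n → Mero (Cn n)}
    {A : Set (OpenPartialHomeomorph (Rn n) (Rn n))} (hA : IsStructureOf f A)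
    (hf : AlgebraicIndependent ℝ f) (c : Rn n) :
    IsAlgebraicOver ℝ f fun i => Mero.shift (toCn c) (f i) := by
  have := (hA.isAlgebraicOver_shift hf (-c)).map (Mero.shift (toCn c))
  simpa only [Mero.shift_shift, ← toCn_add, add_neg_cancel, show toCn (0 : Rn n) = 0 from
    funext fun i => by simp [toCn], Mero.shift_zero] using this

/-- Because `α u + l = α (u + α⁻¹ l)`. -/
theorem compAlgHom_shift_eq {n : ℕ} (α : Matrix.GeneralLinearGroup (Fin n) ℝ) (l : Rn n)
    (m : Mero (Cn n)) :
    Mero.compMatrix α (Mero.shift (toCn l) m) =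
      Mero.shift (toCn (realify α⁻¹ l))
        (Mero.compMatrix α m) := by
  rw [Mero.compMatrix, ← Mero.compAlgHom_shift, complexify_toCn, realify_realify_inv]

/-- If `g ∘ α` is algebraic over `ℝ(f)`, then `α` is a locally Nash map. -/
theorem IsStructureOf.isLocallyNashMap {n : ℕ} {f g : Fin n → Mero (Cn n)}
    {A B : Set (OpenPartialHomeomorph (Rn n) (Rn n))} (hA : IsStructureOf f A)
    (hB : IsStructureOf g B) (hf : AlgebraicIndependent ℝ f)
    {α : Matrix.GeneralLinearGroup (Fin n) ℝ} (h : IsAlgebraicOver ℝ (compGL g α) f) :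
    IsLocallyNashMap A B (realify α) := by
  have hshift := hA.isAlgebraicOver_shift hf
  have hself := hA.isAlgebraicOver_self_shift hf
  obtain ⟨-, φ, hφ, rfl⟩ := hA
  obtain ⟨-, ψ, hψ, rfl⟩ := hB
  obtain ⟨k, hk⟩ := hφ.exists_representations
  obtain ⟨l, hl⟩ := hψ.exists_representations
  have halg : IsAlgebraicOver ℝ (fun i => Mero.compMatrix α
      (Mero.shift (toCn l) (g i))) (fun i => Mero.shift (toCn k) (f i)) := by
    simp only [compAlgHom_shift_eq]
    exact ((h.map (Mero.shift (toCn (realify α⁻¹ l)))).trans (hshift _)).trans (hself k)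
  have hW : IsOpen (φ.source ∩ realify α ⁻¹' ψ.source) :=
    φ.open_source.inter (ψ.open_source.preimage (realify α).continuous)
  obtain ⟨u, hu, V, hV, huV, hVW, hN⟩ := exists_nash_of_isAlgebraicOver (hf.shift k) halg φ
    (h := fun x => ψ (realify α (φ.symm x))) hW
    ⟨0, hφ.zero_mem, by simpa using hψ.zero_mem⟩ inter_subset_left
    (by
      rintro i _ ⟨v, hv, rfl⟩
      have h1 : AnalyticAt ℝ φ.symm (φ v) := hφ.analytic_symm _ (φ.map_source hv.1)
      have h2 : AnalyticAt ℝ ψ (realify α (φ.symm (φ v))) := by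
        rw [φ.left_inv hv.1]
        exact hψ.analytic _ hv.2
      have h3 : AnalyticAt ℝ (fun x => realify α (φ.symm x)) (φ v) :=
        AnalyticAt.comp (g := realify α) (f := φ.symm) ((realify α).analyticAt _) h1
      exact analyticAt_pi_iff.1 (AnalyticAt.comp (g := ψ)
        (f := fun x => realify α (φ.symm x)) h2 h3) i)
    (fun i => representations.mono (hk i) inter_subset_left)
    (fun i => representations.congr
      (representations.mono (representations.comp (hl i) α) inter_subset_right)
      fun v hv => by rw [φ.left_inv hv.1])
  refine ⟨(realify α).continuous, fun p => ?_⟩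
  -- The good point `u` cannot be prescribed, so the charts are translated by `p - u` and by its
  -- image. The local expression of `α` at `p` is then the one already found at `u`.
  refine ⟨translateChart φ (p - u), ⟨p - u, rfl⟩, translateChart ψ (realify α (p - u)),
    ⟨_, rfl⟩, (fun x => -(p - u) + x) ⁻¹' V, hV.preimage (by fun_prop), by simpa using huV,
    fun x hx => (hVW hx).1, fun x hx => ?_, ?_⟩
  · have := (hVW hx).2
    simp only [mem_preimage, map_add, map_neg] at this
    exact this
  · have himg : translateChart φ (p - u) '' ((fun x => -(p - u) + x) ⁻¹' V) = φ '' V := by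
      change (fun x => φ (-(p - u) + x)) '' ((fun x => -(p - u) + x) ⁻¹' V) = φ '' V
      rw [← image_image φ, image_preimage_eq]
      exact (Homeomorph.addLeft (-(p - u))).surjective
    rw [himg]
    convert! hN using 1
    funext x
    change ψ (-(realify α (p - u)) + realify α (- -(p - u) + φ.symm x)) = _
    rw [map_add, neg_neg, neg_add_cancel_left]

/-- A linear locally Nash map `α` makes `g ∘ α` algebraic over `ℝ(f)`. -/
theorem IsStructureOf.isAlgebraicOver_compGL {n : ℕ} {f g : Fin n → Mero (Cn n)}
    {A B : Set (OpenPartialHomeomorph (Rn n) (Rn n))} (hA : IsStructureOf f A)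
    (hB : IsStructureOf g B) (hf : AlgebraicIndependent ℝ f)
    {α : Matrix.GeneralLinearGroup (Fin n) ℝ} (h : IsLocallyNashMap A B (realify α)) :
    IsAlgebraicOver ℝ (compGL g α) f := by
  have hshift := hA.isAlgebraicOver_shift hf
  obtain ⟨-, φ, hφ, rfl⟩ := hA
  obtain ⟨-, ψ, hψ, rfl⟩ := hB
  obtain ⟨k, hk⟩ := hφ.exists_representations
  obtain ⟨l, hl⟩ := hψ.exists_representations
  -- Any point would do, since the relation found on an open set holds globally.
  obtain ⟨_, ⟨a, rfl⟩, _, ⟨b, rfl⟩, U, hU, hp, hUs, hmaps, hN⟩ := h.2 0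
  have halg := hN.isAlgebraicOver (hf.shift (-a + k))
    (g := fun i => Mero.compMatrix α
      (Mero.shift (toCn (-b + l)) (g i))) hU ⟨0, hp⟩
    (fun i => representations.mono (translateChart_representations hk a i) hUs)
    (fun i => representations.congr (representations.mono
      (representations.comp (translateChart_representations hl b i) α) hmaps)
      fun u hu => by rw [OpenPartialHomeomorph.left_inv _ (hUs hu)])
  simp only [compAlgHom_shift_eq] at halg
  have := halg.map (Mero.shift (toCn (-(realify α⁻¹ (-b + l)))))
  simp only [Mero.shift_cancel] at this
  refine this.trans ?_
  simp only [Mero.shift_shift, ← toCn_add]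
  exact hshift _

end

/-! ### The isomorphism criterion -/

theorem corollary4p4 (n : ℕ) (f g : Fin n → Mero (Cn n))
    (hf : IsRealMeromorphic f) (hg : IsRealMeromorphic g)
    (hfA : AdmitsAAT f) (hgA : AdmitsAAT g)
    (A B : Set (OpenPartialHomeomorph (Rn n) (Rn n)))
    (hA : IsStructureOf f A) (hB : IsStructureOf g B) :
    LocallyNashIsomorphic A B ↔
      ∃ α : Matrix.GeneralLinearGroup (Fin n) ℝ, IsAlgebraicOver ℝ (compGL g α) f := by
  have hfi := hfA.algebraicIndependent_real
  have hgi := hgA.algebraicIndependent_real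
  constructor
  · rintro ⟨F, hF, hF'⟩
    -- A continuous additive map between real vector spaces is `ℝ`-linear.
    let T : Rn n →ₗ[ℝ] Rn n := (F.toAddMonoidHom.toRealLinearMap hF.1).toLinearMap
    let T' : Rn n →ₗ[ℝ] Rn n := (F.symm.toAddMonoidHom.toRealLinearMap hF'.1).toLinearMap
    have hTT' : T ∘ₗ T' = LinearMap.id := LinearMap.ext F.apply_symm_apply
    have hT'T : T' ∘ₗ T = LinearMap.id := LinearMap.ext F.symm_apply_apply
    let α : Matrix.GeneralLinearGroup (Fin n) ℝ :=
      ⟨LinearMap.toMatrix' T, LinearMap.toMatrix' T',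
        by rw [← LinearMap.toMatrix'_comp, hTT', LinearMap.toMatrix'_id],
        by rw [← LinearMap.toMatrix'_comp, hT'T, LinearMap.toMatrix'_id]⟩
    have hα : ⇑(realify α) = F := by
      funext x
      change Matrix.toLin' (LinearMap.toMatrix' T) x = F x
      rw [Matrix.toLin'_toMatrix']
      rfl
    exact ⟨α, hA.isAlgebraicOver_compGL hB hfi (by rwa [hα])⟩
  · rintro ⟨α, hα⟩
    have hgα := hgi.compGL α
    -- Exchange makes `f` algebraic over `ℝ(g ∘ α)`; substituting `α⁻¹` gives the hypothesis for the
    -- inverse map.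
    have hα' : IsAlgebraicOver ℝ (compGL f α⁻¹) g := by
      have := (hα.symm hfi hgα).compGL α⁻¹
      rwa [compGL_compGL_inv] at this
    let F : Rn n ≃+ Rn n :=
      { toFun := realify α
        invFun := realify α⁻¹
        left_inv := realify_inv_realify α
        right_inv := realify_realify_inv α
        map_add' := map_add _ }
    exact ⟨F, hA.isLocallyNashMap hB hfi hα, hB.isLocallyNashMap hA hgi hα'⟩
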